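/- Let $\mathcal M=(Q,\mathsf A,\delta)$ be a Markov decision process with a finite set $Q$ of $n=|Q|$ states, a finite nonempty set $\mathsf A$ of actions, and a probabilistic transition function $\delta$ that assigns to each $(q,a)\in Q\times\mathsf A$ a probability distribution $\delta(q,a)$ over $Q$. Let $\alpha$ be the smallest positive value among the transition probabilities $\delta(q,a)(q')$, let $T\subseteq Q$, let $d_0$ be an initial probability distribution over $Q$, and let $\alpha_0$ be the smallest positive value of $d_0$. A (randomized) strategy $\sigma$ maps each finite sequence $q_0a_0q_1a_1\dots q_k$ of alternating states and actions to a probability distribution over $\mathsf A$; for $i\ge 0$ let $\mathcal M^\sigma_i(q)$ be the probability, from $d_0$ and under $\sigma$, of being in state $q$ after exactly $i$ steps, and let $\mathcal M^\sigma_i(T)=\sum_{q\in T}\mathcal M^\sigma_i(q)$. The distribution $d_0$ is almost-sure weakly synchronizing in $T$ if there is a strategy $\sigma$ such that for all $\epsilon>0$ we have $\mathcal M^\sigma_i(T)\ge 1-\epsilon$ for infinitely many $i$. Let $$\epsilon_w=\alpha_0\cdot\frac{\alpha^{(n+2)\cdot 4^n}}{n^{2^n+1}}\qquad\text{and}\qquad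 N_w=2^n .$$ If $d_0$ is not almost-sure weakly synchronizing in $T$, then for all strategies $\sigma$, at most $N_w$ distributions in the sequence $(\mathcal M^\sigma_i)_{i\ge 0}$ are strictly $(1-\epsilon_w)$-synchronized in $T$, that is, $\mathcal M^\sigma_i(T)>1-\epsilon_w$ for at most $N_w$ values of $i$. -/

import Mathlib

/-- Probability distributions over a finite set `X`: functions `d : X → ℝ` with `0 ≤ d x`
and `∑ x, d x = 1`. -/
abbrev Distr (X : Type*) [Fintype X] : Type _ := stdSimplex ℝ X

/-- The probability mass `d(T)` that a function `d` on states assigns to a set `T` of states. -/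
def mass {Q : Type*} (d : Q → ℝ) (T : Finset Q) : ℝ := ∑ q ∈ T, d q

/-- A Markov decision process with finite state set `Q` and finite action set `A`, given by its
probabilistic transition function. -/
structure MDP (Q A : Type*) [Fintype Q] where
  /-- `δ q a q'` is the probability that `q'` is the successor of `q` under the action `a`. -/
  δ : Q → A → Distr Q

/-- Finite sequences `q₀ a₀ q₁ a₁ … qₖ` with `k` actions and `k + 1` states. -/
abbrev History (Q A : Type*) (k : ℕ) : Type _ := (Fin (k + 1) → Q) × (Fin k → A)

/-- The prefix `q₀ a₀ q₁ … qⱼ` of a sequence `q₀ a₀ q₁ … qₖ`, for `j ≤ k`. -/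
def History.take {Q A : Type*} {k : ℕ} (ρ : History Q A k) (j : ℕ) (h : j ≤ k) :
    History Q A j :=
  (fun m => ρ.1 (Fin.castLE (Nat.succ_le_succ h) m), fun m => ρ.2 (Fin.castLE h m))

/-- Randomized history-dependent strategies: functions from `(Q A)* Q` to the distributions
over actions. -/
abbrev Strategy (Q A : Type*) [Fintype A] : Type _ := ∀ k : ℕ, History Q A k → Distr A

namespace MDP

variable {Q A : Type*} [Fintype Q] [Fintype A]

/-- The set of positive transition probabilities of an MDP. -/
def positiveProbs (M : MDP Q A) : Set ℝ := {p | 0 < p ∧ ∃ q a q', M.δ q a q' = p}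

/-- The probability of (the cylinder of) the finite sequence `ρ = q₀ a₀ q₁ … qₖ` from the initial
distribution `d₀` under the strategy `σ`:
`d₀(q₀) · ∏_{j < k} σ(q₀ a₀ … qⱼ)(aⱼ) · δ(qⱼ, aⱼ)(qⱼ₊₁)`. -/
noncomputable def prob (M : MDP Q A) (d₀ : Distr Q) (σ : Strategy Q A) {k : ℕ}
    (ρ : History Q A k) : ℝ :=
  d₀ (ρ.1 0) * ∏ j : Fin k,
    (σ j (ρ.take j j.2.le) (ρ.2 j) * M.δ (ρ.1 j.castSucc) (ρ.2 j) (ρ.1 j.succ))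

/-- The sequence of state distributions generated by `σ` from `d₀`: `M.outcome d₀ σ i q` is the
probability of being in `q` after exactly `i` steps, that is the total probability of the
(pairwise disjoint) cylinders of the sequences with `i` actions that end in `q`. -/
noncomputable def outcome [DecidableEq Q] (M : MDP Q A) (d₀ : Distr Q) (σ : Strategy Q A)
    (i : ℕ) (q : Q) : ℝ :=
  ∑ ρ : History Q A i, if ρ.1 (Fin.last i) = q then M.prob d₀ σ ρ else 0

end MDP

/-- A distribution is `p`-synchronized in `T` if it assigns mass at least `p` to `T`. -/
def IsSynchronized {Q : Type*} (p : ℝ) (d : Q → ℝ) (T : Finset Q) : Prop := p ≤ mass d T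

/-- A distribution is strictly `p`-synchronized in `T` if it assigns mass more than `p` to `T`. -/
def IsStrictlySynchronized {Q : Type*} (p : ℝ) (d : Q → ℝ) (T : Finset Q) : Prop := p < mass d T

/-- A sequence of distributions is weakly `p`-synchronizing in `T` if infinitely many of its
elements are `p`-synchronized in `T`. -/
def IsWeaklySynchronizing {Q : Type*} (p : ℝ) (d : ℕ → Q → ℝ) (T : Finset Q) : Prop :=
  {i : ℕ | IsSynchronized p (d i) T}.Infinite

/-- The almost-sure winning region for weakly synchronizing in `T`: the initial distributions
from which a single strategy is weakly `(1 - ε)`-synchronizing in `T` for all `ε > 0`. -/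
def MDP.almostSureWeakly {Q A : Type*} [Fintype Q] [Fintype A] [DecidableEq Q] (M : MDP Q A)
    (T : Finset Q) : Set (Distr Q) :=
  {d₀ | ∃ σ : Strategy Q A, ∀ ε : ℝ, 0 < ε → IsWeaklySynchronizing (1 - ε) (M.outcome d₀ σ) T}

/-!
Put `b = α ^ (n * 2 ^ n) / n`. At the `m`-th of `2 ^ n + 1` nearly synchronized positions, consider
the set of states of mass at least `α₀ * b ^ (m + 1)`. It is contained in `T` and carries all but a
fraction of the mass, and by the pigeonhole principle the same set `S` occurs at two positions.
Hence `S` is reached after a fixed number of steps, with failure probability less than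
`α ^ (n * 2 ^ n)`, both from the support of `d₀` and from each state of `S`.

Failure probabilities this small can be made arbitrarily small. The sets of states from which `S`
is surely reached in `k` steps are eventually periodic in `k`, say with period `r` from `k₀` on.
The infima of the failure probabilities over `k, k + r, k + 2 * r, …` have a gap: they are `0` or at
least `α ^ (k₀ + n * r)`, because a smaller maximal value could only be passed on among states where
it is attained, which never meet `S`. So `S` is reached limit-surely from `d₀` and from itself, and
reaching it again and again with errors tending to `0` is almost-sure weakly synchronizing in `T`.
-/

open scoped NNReal

lemma exists_lt_map_eq_of_card_lt {ι X : Type*} [Fintype ι] [LinearOrder ι] [Fintype X]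
    (f : ι → X) (h : Fintype.card X < Fintype.card ι) : ∃ i j, i < j ∧ f i = f j := by
  obtain ⟨i, j, hij, hf⟩ := Fintype.exists_ne_map_eq_of_card_lt f h
  rcases hij.lt_or_gt with hlt | hlt
  exacts [⟨i, j, hlt, hf⟩, ⟨j, i, hlt, hf.symm⟩]

lemma exists_strictMono_of_lt_encard {X : Type*} [LinearOrder X] {s : Set X} {N : ℕ}
    (h : (N : ℕ∞) < s.encard) : ∃ e : Fin (N + 1) → X, StrictMono e ∧ ∀ m, e m ∈ s := by
  obtain ⟨t, hts, ht⟩ := Set.exists_subset_encard_eq (Order.add_one_le_of_lt h)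
  lift t to Finset X using Set.finite_of_encard_eq_coe ht
  have hcard : t.card = N + 1 := by
    rw [Set.encard_coe_eq_coe_finsetCard] at ht
    exact_mod_cast ht
  exact ⟨t.orderEmbOfFin hcard, (t.orderEmbOfFin hcard).strictMono,
    fun m => hts (t.orderEmbOfFin_mem hcard m)⟩

lemma exists_ge_of_countdown {k n : ℕ → ℕ}
    (h : ∀ i, (k i = k (i + 1) + 1 ∧ n (i + 1) = n i) ∨ (k i = 0 ∧ n (i + 1) = n i + 1))
    (h0 : n 0 = 0) (m : ℕ) : ∃ i, m ≤ i ∧ k i = 0 ∧ n i = m := by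
  have hzero : ∀ c i, k i = c → ∃ j, i ≤ j ∧ k j = 0 ∧ n j = n i := by
    intro c
    induction c with
    | zero => exact fun i hi => ⟨i, le_rfl, hi, rfl⟩
    | succ c ih =>
      intro i hi
      rcases h i with ⟨hk, hn⟩ | ⟨hk, -⟩
      · obtain ⟨j, hij, hj, hnj⟩ := ih (i + 1) (by omega)
        exact ⟨j, by omega, hj, hnj.trans hn⟩
      · omega
  induction m with
  | zero =>
    obtain ⟨i, -, hi, hn⟩ := hzero _ 0 rfl
    exact ⟨i, i.zero_le, hi, hn.trans h0⟩
  | succ m ih =>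
    obtain ⟨i, hmi, hi, hn⟩ := ih
    rcases h i with ⟨hk, -⟩ | ⟨-, hn'⟩
    · omega
    · obtain ⟨j, hij, hj, hnj⟩ := hzero _ (i + 1) rfl
      exact ⟨j, by omega, hj, by omega⟩

lemma exists_forall_lt_or_le {X β : Type*} [Fintype X] [LinearOrder β] {u : ℕ → β}
    (hu : Antitone u) (f : X → β) :
    ∃ m ≤ Fintype.card X, ∀ x, f x < u (m + 1) ∨ u m ≤ f x := by
  by_contra! h
  choose x hx using fun m : Fin (Fintype.card X + 1) => h m (Nat.lt_succ_iff.1 m.2)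
  obtain ⟨i, j, hij, hxij⟩ := exists_lt_map_eq_of_card_lt x (by simp)
  exact ((hx i).1.trans_lt (hxij ▸ (hx j).2)).not_ge (hu hij)

lemma pow_div_pow_le {α : ℝ≥0} (hα : α ≤ 1) (n : ℕ) :
    α ^ ((n + 2) * 4 ^ n) / (n : ℝ≥0) ^ (2 ^ n + 1) ≤ (α ^ (n * 2 ^ n) / n) ^ (2 ^ n + 1) := by
  have hexp : n * 2 ^ n * (2 ^ n + 1) ≤ (n + 2) * 4 ^ n := by
    have hn : n ≤ 2 ^ n := Nat.lt_two_pow_self.le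
    rw [show 4 = 2 * 2 from rfl, mul_pow]
    nlinarith
  rw [div_pow, ← pow_mul]
  gcongr ?_ / _
  exact pow_le_pow_of_le_one zero_le hα hexp

namespace Distr

variable {X : Type*} [Fintype X]

/-- A distribution as a measure with values in `ℝ≥0`, the form in which masses are estimated. -/
noncomputable def toNNReal (d : Distr X) (x : X) : ℝ≥0 := ⟨d x, stdSimplex.zero_le d x⟩

lemma coe_toNNReal (d : Distr X) (x : X) : (d.toNNReal x : ℝ) = d x := rfl

lemma sum_toNNReal (d : Distr X) : ∑ x, d.toNNReal x = 1 := by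
  apply NNReal.coe_injective
  push_cast [coe_toNNReal]
  exact stdSimplex.sum_eq_one d

lemma exists_sum_mul_toNNReal_eq [Nonempty X] (f : X → ℝ≥0) :
    ∃ d : Distr X, ∀ x, (∑ y, f y) * d.toNNReal x = f x := by
  classical
  rcases eq_or_ne (∑ y, f y) 0 with h | h
  · have hf : ∀ x, f x = 0 := by simpa using h
    exact ⟨⟨_, single_mem_stdSimplex ℝ (Classical.arbitrary X)⟩, by simp [hf]⟩
  · have hcoe : ∑ x, (f x : ℝ) ≠ 0 := by exact_mod_cast h
    refine ⟨⟨fun x => f x / ∑ y, (f y : ℝ), fun x => by positivity, ?_⟩, fun x => ?_⟩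
    · rw [← Finset.sum_div, div_self hcoe]
    · apply NNReal.coe_injective
      push_cast [coe_toNNReal]
      exact mul_div_cancel₀ _ hcoe

end Distr

namespace MDP

section Transitions

variable {Q A : Type*} [Fintype Q] {M : MDP Q A}

/-- Transition probabilities with values in `ℝ≥0`. -/
noncomputable def tr (M : MDP Q A) (q : Q) (a : A) : Q → ℝ≥0 := (M.δ q a).toNNReal

lemma tr_dotProduct_const (M : MDP Q A) (q : Q) (a : A) (c : ℝ≥0) :
    (M.tr q a ⬝ᵥ fun _ => c) = c := by
  rw [dotProduct, ← Finset.sum_mul, tr, Distr.sum_toNNReal, one_mul]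

lemma tr_dotProduct_mono (M : MDP Q A) (q : Q) (a : A) {v w : Q → ℝ≥0} (h : v ≤ w) :
    M.tr q a ⬝ᵥ v ≤ M.tr q a ⬝ᵥ w :=
  dotProduct_le_dotProduct_of_nonneg_left h fun _ => zero_le

lemma tr_dotProduct_le {q : Q} {a : A} {w : Q → ℝ≥0} {c : ℝ≥0}
    (h : ∀ p ∈ (M.tr q a).support, w p ≤ c) : M.tr q a ⬝ᵥ w ≤ c := by
  rw [← tr_dotProduct_const M q a c]
  refine Finset.sum_le_sum fun p _ => ?_
  by_cases hp : M.tr q a p = 0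
  · simp [hp]
  · gcongr; exact h p hp

lemma le_tr_dotProduct {q : Q} {a : A} {w : Q → ℝ≥0} {c : ℝ≥0}
    (h : ∀ p ∈ (M.tr q a).support, c ≤ w p) : c ≤ M.tr q a ⬝ᵥ w := by
  rw [← tr_dotProduct_const M q a c]
  refine Finset.sum_le_sum fun p _ => ?_
  by_cases hp : M.tr q a p = 0
  · simp [hp]
  · gcongr; exact h p hp

lemma eq_of_le_tr_dotProduct {q : Q} {a : A} {w : Q → ℝ≥0} {c : ℝ≥0}
    (h : ∀ p ∈ (M.tr q a).support, w p ≤ c) (hc : c ≤ M.tr q a ⬝ᵥ w) {p : Q}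
    (hp : p ∈ (M.tr q a).support) : w p = c := by
  have hle : ∀ x ∈ Finset.univ, M.tr q a x * w x ≤ M.tr q a x * c := fun x _ => by
    by_cases hx : M.tr q a x = 0
    · simp [hx]
    · gcongr; exact h x hx
  have hsum : ∑ x, M.tr q a x * w x = ∑ x, M.tr q a x * c :=
    (tr_dotProduct_le h).trans (tr_dotProduct_const M q a c).ge |>.antisymm
      ((tr_dotProduct_const M q a c).le.trans hc)
  exact mul_left_cancel₀ hp ((Finset.sum_eq_sum_iff_of_le hle).1 hsum p (Finset.mem_univ p))

/-- `α` bounds all positive transition probabilities from below. -/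
def IsProbLowerBound (M : MDP Q A) (α : ℝ≥0) : Prop :=
  ∀ q a q', M.tr q a q' ≠ 0 → α ≤ M.tr q a q'

lemma IsProbLowerBound.mul_le_tr_dotProduct {α : ℝ≥0} (hα : M.IsProbLowerBound α) {q p : Q} {a : A}
    {w : Q → ℝ≥0} {c : ℝ≥0} (hp : p ∈ (M.tr q a).support) (hc : c ≤ w p) :
    α * c ≤ M.tr q a ⬝ᵥ w :=
  (mul_le_mul' (hα q a p hp) hc).trans
    (Finset.single_le_sum (f := fun p => M.tr q a p * w p) (fun _ _ => zero_le)
      (Finset.mem_univ p))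

lemma IsProbLowerBound.le_one [Nonempty A] {α : ℝ≥0} (hα : M.IsProbLowerBound α) (q : Q) :
    α ≤ 1 := by
  obtain ⟨a⟩ := ‹Nonempty A›
  have hone := tr_dotProduct_const M q a 1
  obtain ⟨p, hp⟩ : (M.tr q a).support.Nonempty := by
    rw [Function.support_nonempty_iff]
    intro h
    simp [h] at hone
  simpa [hone] using hα.mul_le_tr_dotProduct hp (w := fun _ => 1) le_rfl

/-- The mass that a measure assigns to the complement of `E`. -/
noncomputable def outside (E : Set Q) (μ : Q → ℝ≥0) : ℝ≥0 := μ ⬝ᵥ Eᶜ.indicator 1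

lemma outside_anti {E F : Set Q} (h : E ⊆ F) (μ : Q → ℝ≥0) : outside F μ ≤ outside E μ :=
  dotProduct_le_dotProduct_of_nonneg_left
    (Set.indicator_le_indicator_of_subset (Set.compl_subset_compl.2 h) fun _ => zero_le)
    fun _ => zero_le

lemma le_outside {E : Set Q} {q : Q} (hq : q ∉ E) (μ : Q → ℝ≥0) : μ q ≤ outside E μ := by
  have := Finset.single_le_sum (f := fun p => μ p * Eᶜ.indicator 1 p) (fun _ _ => zero_le)
    (Finset.mem_univ q)
  simpa [hq, outside, dotProduct] using this

lemma outside_setOf_le_lt [Nonempty Q] {θ : ℝ≥0} (hθ : θ ≠ 0) (μ : Q → ℝ≥0) :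
    outside {q | θ ≤ μ q} μ < Fintype.card Q * θ := by
  rw [← nsmul_eq_mul, ← Finset.card_univ, ← Finset.sum_const]
  refine Finset.sum_lt_sum_of_nonempty Finset.univ_nonempty fun q _ => ?_
  by_cases hq : θ ≤ μ q
  · simpa [hq] using pos_iff_ne_zero.2 hθ
  · simpa [hq] using not_le.1 hq

lemma mass_add_outside (T : Finset Q) (μ : Q → ℝ≥0) :
    mass (fun q => (μ q : ℝ)) T + outside (T : Set Q) μ = ∑ q, μ q := by
  classical
  have hsum : ∑ q ∈ T, μ q + outside (T : Set Q) μ = ∑ q, μ q := by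
    rw [← Finset.sum_add_sum_compl T μ]
    simp [outside, dotProduct, Set.indicator_apply, Finset.sum_ite, Finset.filter_not,
      Finset.compl_eq_univ_sdiff]
  rw [mass]
  exact_mod_cast hsum

/-- The measure `ν` is obtained from `μ` by one transition: of the mass `μ q`, the part `f q a`
plays the action `a`. -/
def Step [Fintype A] (M : MDP Q A) (μ ν : Q → ℝ≥0) : Prop :=
  ∃ f : Q → A → ℝ≥0, (∀ q, ∑ a, f q a = μ q) ∧ ∑ q, ∑ a, f q a • M.tr q a = ν

/-- The measure `ν` is obtained from `μ` by `k` transitions. -/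
def Reach [Fintype A] (M : MDP Q A) : ℕ → (Q → ℝ≥0) → (Q → ℝ≥0) → Prop
  | 0, μ, ν => μ = ν
  | k + 1, μ, ν => ∃ ρ, M.Step μ ρ ∧ Reach M k ρ ν

variable [Fintype A]

lemma sum_smul_tr_dotProduct (f : Q → A → ℝ≥0) (w : Q → ℝ≥0) :
    (∑ q, ∑ a, f q a • M.tr q a) ⬝ᵥ w = ∑ q, ∑ a, f q a * (M.tr q a ⬝ᵥ w) := by
  simp only [sum_dotProduct, smul_dotProduct, smul_eq_mul]

lemma Step.sum_eq {μ ν : Q → ℝ≥0} (h : M.Step μ ν) : ∑ q, ν q = ∑ q, μ q := by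
  obtain ⟨f, hf, rfl⟩ := h
  calc ∑ q, (∑ p, ∑ a, f p a • M.tr p a) q
      = (∑ p, ∑ a, f p a • M.tr p a) ⬝ᵥ fun _ => 1 := by simp only [dotProduct, mul_one]
    _ = ∑ p, ∑ a, f p a := by simp only [sum_smul_tr_dotProduct, tr_dotProduct_const, mul_one]
    _ = ∑ q, μ q := by simp only [hf]

lemma Step.of_choice (M : MDP Q A) (μ : Q → ℝ≥0) (s : Q → A) :
    M.Step μ (∑ q, μ q • M.tr q (s q)) := by
  classical
  refine ⟨fun q => Pi.single (s q) (μ q), fun q => by simp, Finset.sum_congr rfl fun q _ => ?_⟩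
  rw [Finset.sum_eq_single (s q)] <;> simp +contextual

lemma Reach.of_steps {d : ℕ → Q → ℝ≥0} (hd : ∀ i, M.Step (d i) (d (i + 1))) (i k : ℕ) :
    M.Reach k (d i) (d (i + k)) := by
  induction k generalizing i with
  | zero => rfl
  | succ k ih => exact ⟨_, hd i, by simpa only [Nat.succ_add_eq_add_succ] using ih (i + 1)⟩

lemma sum_eq_of_steps {d : ℕ → Q → ℝ≥0} (hd : ∀ i, M.Step (d i) (d (i + 1))) (i : ℕ) :
    ∑ q, d i q = ∑ q, d 0 q := by
  induction i with
  | zero => rfl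
  | succ i ih => rw [(hd i).sum_eq, ih]

end Transitions

section Outcomes

variable {Q A : Type*}

/-- Splitting off the last action and the last state of a history. -/
def historySnocEquiv (Q A : Type*) (k : ℕ) : (History Q A k × A × Q) ≃ History Q A (k + 1) where
  toFun x := (Fin.snoc x.1.1 x.2.2, Fin.snoc x.1.2 x.2.1)
  invFun ρ := ((Fin.init ρ.1, Fin.init ρ.2), ρ.2 (Fin.last k), ρ.1 (Fin.last (k + 1)))
  left_inv x := by simp only [Fin.init_snoc, Fin.snoc_last]
  right_inv ρ := by simp only [Fin.snoc_init_self]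

lemma historySnocEquiv_fst_castSucc {k : ℕ} (ρ : History Q A k) (a : A) (q : Q) (j : Fin (k + 1)) :
    (historySnocEquiv Q A k (ρ, a, q)).1 j.castSucc = ρ.1 j :=
  Fin.snoc_castSucc (α := fun _ => Q) q ρ.1 j

lemma historySnocEquiv_fst_last {k : ℕ} (ρ : History Q A k) (a : A) (q : Q) :
    (historySnocEquiv Q A k (ρ, a, q)).1 (Fin.last (k + 1)) = q :=
  Fin.snoc_last (α := fun _ => Q) q ρ.1

lemma historySnocEquiv_snd_castSucc {k : ℕ} (ρ : History Q A k) (a : A) (q : Q) (j : Fin k) :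
    (historySnocEquiv Q A k (ρ, a, q)).2 j.castSucc = ρ.2 j :=
  Fin.snoc_castSucc (α := fun _ => A) a ρ.2 j

lemma historySnocEquiv_snd_last {k : ℕ} (ρ : History Q A k) (a : A) (q : Q) :
    (historySnocEquiv Q A k (ρ, a, q)).2 (Fin.last k) = a :=
  Fin.snoc_last (α := fun _ => A) a ρ.2

lemma take_historySnocEquiv {k : ℕ} (ρ : History Q A k) (a : A) (q : Q) (j : ℕ) (h : j ≤ k) :
    (historySnocEquiv Q A k (ρ, a, q)).take j (h.trans k.le_succ) = ρ.take j h :=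
  Prod.ext (funext fun m => historySnocEquiv_fst_castSucc ρ a q (Fin.castLE _ m))
    (funext fun m => historySnocEquiv_snd_castSucc ρ a q (Fin.castLE h m))

variable [Fintype Q] [Fintype A]

lemma prob_historySnocEquiv (M : MDP Q A) (d₀ : Distr Q) (σ : Strategy Q A) {k : ℕ}
    (ρ : History Q A k) (a : A) (q : Q) :
    M.prob d₀ σ (historySnocEquiv Q A k (ρ, a, q)) =
      M.prob d₀ σ ρ * σ k ρ a * M.δ (ρ.1 (Fin.last k)) a q := by
  have hlast : σ k ((historySnocEquiv Q A k (ρ, a, q)).take k k.le_succ) = σ k ρ :=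
    congrArg (σ k) (take_historySnocEquiv ρ a q k le_rfl)
  have hinit (j : Fin k) :
      σ j ((historySnocEquiv Q A k (ρ, a, q)).take j (j.2.le.trans k.le_succ)) =
        σ j (ρ.take j j.2.le) :=
    congrArg (σ j) (take_historySnocEquiv ρ a q j j.2.le)
  unfold prob
  rw [Fin.prod_univ_castSucc, ← Fin.castSucc_zero, Fin.succ_last]
  simp only [Fin.succ_castSucc, historySnocEquiv_fst_castSucc, historySnocEquiv_fst_last,
    historySnocEquiv_snd_castSucc, historySnocEquiv_snd_last, Fin.val_castSucc, Fin.val_last,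
    hlast, hinit, mul_assoc]

lemma prob_nonneg (M : MDP Q A) (d₀ : Distr Q) (σ : Strategy Q A) {k : ℕ} (ρ : History Q A k) :
    0 ≤ M.prob d₀ σ ρ :=
  mul_nonneg (stdSimplex.zero_le d₀ _) <| Finset.prod_nonneg fun _ _ =>
    mul_nonneg (stdSimplex.zero_le (σ _ _) _) (stdSimplex.zero_le (M.δ _ _) _)

variable [DecidableEq Q]

/-- The probability of being in `q` after `k` steps and then playing `a`. -/
noncomputable def flow (M : MDP Q A) (d₀ : Distr Q) (σ : Strategy Q A) (k : ℕ) (q : Q) (a : A) :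
    ℝ≥0 :=
  ⟨∑ ρ : History Q A k, if ρ.1 (Fin.last k) = q then M.prob d₀ σ ρ * σ k ρ a else 0,
    Finset.sum_nonneg fun ρ _ => by
      split_ifs
      exacts [mul_nonneg (prob_nonneg M d₀ σ ρ) (stdSimplex.zero_le (σ k ρ) a), le_rfl]⟩

lemma coe_flow (M : MDP Q A) (d₀ : Distr Q) (σ : Strategy Q A) (k : ℕ) (q : Q) (a : A) :
    (M.flow d₀ σ k q a : ℝ) =
      ∑ ρ : History Q A k, if ρ.1 (Fin.last k) = q then M.prob d₀ σ ρ * σ k ρ a else 0 :=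
  rfl

lemma outcome_zero (M : MDP Q A) (d₀ : Distr Q) (σ : Strategy Q A) (q : Q) :
    M.outcome d₀ σ 0 q = d₀ q := by
  unfold outcome
  rw [← (Equiv.prodUnique (Fin 1 → Q) (Fin 0 → A)).symm.sum_comp,
    ← (Equiv.funUnique (Fin 1) Q).symm.sum_comp]
  simp [prob]

lemma outcome_succ (M : MDP Q A) (d₀ : Distr Q) (σ : Strategy Q A) (k : ℕ) (q' : Q) :
    M.outcome d₀ σ (k + 1) q' = ∑ q, ∑ a, M.flow d₀ σ k q a * M.δ q a q' := by
  calc M.outcome d₀ σ (k + 1) q'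
      = ∑ ρ : History Q A k, ∑ a, M.prob d₀ σ ρ * σ k ρ a * M.δ (ρ.1 (Fin.last k)) a q' := by
        unfold outcome
        rw [← (historySnocEquiv Q A k).sum_comp]
        simp only [Fintype.sum_prod_type, historySnocEquiv_fst_last, prob_historySnocEquiv,
          Finset.sum_ite_eq', Finset.mem_univ, if_true]
    _ = ∑ ρ : History Q A k, ∑ a, ∑ q,
          (if ρ.1 (Fin.last k) = q then M.prob d₀ σ ρ * σ k ρ a else 0) * M.δ q a q' := by
        simp only [ite_mul, zero_mul, Finset.sum_ite_eq, Finset.mem_univ, if_true]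
    _ = ∑ q, ∑ a, M.flow d₀ σ k q a * M.δ q a q' := by
        simp only [coe_flow, Finset.sum_mul]
        rw [Finset.sum_comm_cycle]
        exact Finset.sum_congr rfl fun _ _ => Finset.sum_comm

lemma sum_flow (M : MDP Q A) (d₀ : Distr Q) (σ : Strategy Q A) (k : ℕ) (q : Q) :
    ∑ a, (M.flow d₀ σ k q a : ℝ) = M.outcome d₀ σ k q := by
  simp only [coe_flow, outcome]
  rw [Finset.sum_comm]
  refine Finset.sum_congr rfl fun ρ _ => ?_
  split_ifs
  · rw [← Finset.mul_sum, stdSimplex.sum_eq_one, mul_one]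
  · exact Finset.sum_const_zero

lemma flow_eq_of_markov (M : MDP Q A) (d₀ : Distr Q) {σ : Strategy Q A} {k : ℕ} {x : Q → Distr A}
    (hσ : ∀ ρ : History Q A k, σ k ρ = x (ρ.1 (Fin.last k))) (q : Q) (a : A) :
    (M.flow d₀ σ k q a : ℝ) = M.outcome d₀ σ k q * x q a := by
  rw [coe_flow, outcome, Finset.sum_mul]
  refine Finset.sum_congr rfl fun ρ _ => ?_
  split_ifs with h
  · rw [hσ, h]
  · rw [zero_mul]

/-- The state distributions generated by a strategy, as measures with values in `ℝ≥0`. -/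
noncomputable def outcomeMeasure (M : MDP Q A) (d₀ : Distr Q) (σ : Strategy Q A) (k : ℕ) (q : Q) :
    ℝ≥0 :=
  ∑ a, M.flow d₀ σ k q a

lemma coe_outcomeMeasure (M : MDP Q A) (d₀ : Distr Q) (σ : Strategy Q A) (k : ℕ) (q : Q) :
    (M.outcomeMeasure d₀ σ k q : ℝ) = M.outcome d₀ σ k q := by
  rw [outcomeMeasure, NNReal.coe_sum, sum_flow]

lemma outcomeMeasure_zero (M : MDP Q A) (d₀ : Distr Q) (σ : Strategy Q A) :
    M.outcomeMeasure d₀ σ 0 = d₀.toNNReal :=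
  funext fun q => NNReal.coe_injective <|
    (coe_outcomeMeasure M d₀ σ 0 q).trans (outcome_zero M d₀ σ q)

lemma outcomeMeasure_succ (M : MDP Q A) (d₀ : Distr Q) (σ : Strategy Q A) (k : ℕ) :
    M.outcomeMeasure d₀ σ (k + 1) = ∑ q, ∑ a, M.flow d₀ σ k q a • M.tr q a := by
  ext q'
  simp only [coe_outcomeMeasure, outcome_succ, Finset.sum_apply, Pi.smul_apply, smul_eq_mul,
    NNReal.coe_sum, NNReal.coe_mul, tr, Distr.coe_toNNReal]

lemma step_outcomeMeasure (M : MDP Q A) (d₀ : Distr Q) (σ : Strategy Q A) (k : ℕ) :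
    M.Step (M.outcomeMeasure d₀ σ k) (M.outcomeMeasure d₀ σ (k + 1)) :=
  ⟨M.flow d₀ σ k, fun _ => rfl, (outcomeMeasure_succ M d₀ σ k).symm⟩

lemma mass_outcome (M : MDP Q A) (d₀ : Distr Q) (σ : Strategy Q A) (T : Finset Q) (i : ℕ) :
    mass (M.outcome d₀ σ i) T = 1 - outside (T : Set Q) (M.outcomeMeasure d₀ σ i) := by
  have hsum : ∑ q, M.outcomeMeasure d₀ σ i q = 1 := by
    rw [sum_eq_of_steps (step_outcomeMeasure M d₀ σ), outcomeMeasure_zero, Distr.sum_toNNReal]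
  have hmass := mass_add_outside T (M.outcomeMeasure d₀ σ i)
  rw [hsum, NNReal.coe_one, funext (coe_outcomeMeasure M d₀ σ i)] at hmass
  exact eq_sub_of_add_eq hmass

lemma exists_outcomeMeasure_eq [Nonempty A] {M : MDP Q A} {d₀ : Distr Q} {d : ℕ → Q → ℝ≥0}
    (h0 : d 0 = d₀.toNNReal) (hd : ∀ i, M.Step (d i) (d (i + 1))) :
    ∃ σ : Strategy Q A, M.outcomeMeasure d₀ σ = d := by
  choose f hf hf' using hd
  choose x hx using fun i q => Distr.exists_sum_mul_toNNReal_eq (f i q)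
  refine ⟨fun k ρ => x k (ρ.1 (Fin.last k)), funext fun i => ?_⟩
  induction i with
  | zero => rw [outcomeMeasure_zero, h0]
  | succ k ih =>
    rw [outcomeMeasure_succ, ← hf' k]
    refine Finset.sum_congr rfl fun q _ => Finset.sum_congr rfl fun a _ => congrArg (· • _) ?_
    rw [← hx, hf, ← ih]
    apply NNReal.coe_injective
    rw [flow_eq_of_markov M d₀ (fun _ => rfl), NNReal.coe_mul, coe_outcomeMeasure,
      Distr.coe_toNNReal]

lemma mem_almostSureWeakly_of_steps [Nonempty A] {M : MDP Q A} {T : Finset Q} {d₀ : Distr Q}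
    {d : ℕ → Q → ℝ≥0} (h0 : d 0 = d₀.toNNReal) (hd : ∀ i, M.Step (d i) (d (i + 1)))
    (hT : ∀ ε : ℝ≥0, ε ≠ 0 → {i | outside (T : Set Q) (d i) ≤ ε}.Infinite) :
    d₀ ∈ M.almostSureWeakly T := by
  obtain ⟨σ, rfl⟩ := exists_outcomeMeasure_eq h0 hd
  refine ⟨σ, fun ε hε => (hT ⟨ε, hε.le⟩ (NNReal.coe_ne_zero.1 hε.ne')).mono fun i hi => ?_⟩
  have hi' : (outside (T : Set Q) (M.outcomeMeasure d₀ σ i) : ℝ) ≤ ε := NNReal.coe_le_coe.2 hi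
  change 1 - ε ≤ mass (M.outcome d₀ σ i) T
  rw [mass_outcome]
  exact sub_le_sub_left hi' 1

end Outcomes

section Concatenation

variable {Q A : Type*} [Fintype Q] [Fintype A] {M : MDP Q A}

lemma exists_steps_of_reach {P : ℕ → (Q → ℝ≥0) → Prop}
    (hP : ∀ m μ, P m μ → ∃ k ν, M.Reach (k + 1) μ ν ∧ P (m + 1) ν) {μ₀ : Q → ℝ≥0} (h0 : P 0 μ₀) :
    ∃ d : ℕ → Q → ℝ≥0, d 0 = μ₀ ∧ (∀ i, M.Step (d i) (d (i + 1))) ∧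
      ∀ m, ∃ i, m ≤ i ∧ P m (d i) := by
  -- A state `(μ, k, m)` consists of the current measure, the number of steps left until the next
  -- measure required to satisfy `P`, and the index of this requirement.
  let Valid : (Q → ℝ≥0) × ℕ × ℕ → Prop := fun x => ∃ ν, M.Reach x.2.1 x.1 ν ∧ P x.2.2 ν
  have hnext : ∀ x : {x // Valid x}, ∃ y : {x // Valid x}, M.Step x.1.1 y.1.1 ∧
      ((x.1.2.1 = y.1.2.1 + 1 ∧ y.1.2.2 = x.1.2.2) ∨
        (x.1.2.1 = 0 ∧ y.1.2.2 = x.1.2.2 + 1)) := by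
    rintro ⟨⟨μ, k, m⟩, ν, hreach, hν⟩
    cases k with
    | succ k =>
      obtain ⟨ρ, hstep, hreach⟩ := hreach
      exact ⟨⟨⟨ρ, k, m⟩, ν, hreach, hν⟩, hstep, Or.inl ⟨rfl, rfl⟩⟩
    | zero =>
      obtain rfl : μ = ν := hreach
      obtain ⟨k, ν', ⟨ρ, hstep, hreach⟩, hν'⟩ := hP m μ hν
      exact ⟨⟨⟨ρ, k, m + 1⟩, ν', hreach, hν'⟩, hstep, Or.inr ⟨rfl, rfl⟩⟩
  choose next hstep hnext using hnext
  let X : ℕ → {x // Valid x} := fun i => next^[i] ⟨⟨μ₀, 0, 0⟩, μ₀, rfl, h0⟩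
  have hX : ∀ i, X (i + 1) = next (X i) := fun i => Function.iterate_succ_apply' _ _ _
  refine ⟨fun i => (X i).1.1, rfl, fun i => by simpa only [hX] using hstep (X i), fun m => ?_⟩
  obtain ⟨i, hmi, hk, hm⟩ := exists_ge_of_countdown (k := fun i => (X i).1.2.1)
    (n := fun i => (X i).1.2.2) (fun i => by simpa only [hX] using hnext (X i)) rfl m
  obtain ⟨ν, hreach, hν⟩ := (X i).2
  rw [hk] at hreach
  rw [hm] at hν
  obtain rfl : (X i).1.1 = ν := hreach
  exact ⟨i, hmi, hν⟩

lemma mem_almostSureWeakly_of_recurrent [DecidableEq Q] [Nonempty A] {T : Finset Q}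
    {G : Set (Q → ℝ≥0)}
    (hG : ∀ μ ∈ G, ∀ ε : ℝ≥0, ε ≠ 0 →
      ∃ k ν, M.Reach (k + 1) μ ν ∧ ν ∈ G ∧ outside (T : Set Q) ν ≤ ε)
    {d₀ : Distr Q} (hd₀ : d₀.toNNReal ∈ G) : d₀ ∈ M.almostSureWeakly T := by
  let P : ℕ → (Q → ℝ≥0) → Prop := fun m μ => μ ∈ G ∧ m * outside (T : Set Q) μ ≤ 1
  have hP : ∀ m μ, P m μ → ∃ k ν, M.Reach (k + 1) μ ν ∧ P (m + 1) ν := fun m μ hμ => by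
    obtain ⟨k, ν, hreach, hν, hle⟩ := hG μ hμ.1 ((m + 1 : ℕ) : ℝ≥0)⁻¹ (by positivity)
    exact ⟨k, ν, hreach, hν, by rwa [← le_inv_mul_iff₀ (by positivity), mul_one]⟩
  obtain ⟨d, h0, hd, hout⟩ := exists_steps_of_reach hP (μ₀ := d₀.toNNReal)
    ⟨hd₀, by rw [Nat.cast_zero, zero_mul]; exact zero_le⟩
  refine mem_almostSureWeakly_of_steps h0 hd fun ε hε =>
    Nat.frequently_atTop_iff_infinite.1 (Filter.frequently_atTop.2 fun N => ?_)
  obtain ⟨m, hm⟩ := exists_nat_ge ε⁻¹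
  obtain ⟨i, hi, -, hle⟩ := hout (max m N)
  have hcast : (m : ℝ≥0) ≤ (max m N : ℕ) := Nat.cast_le.2 (le_max_left m N)
  refine ⟨i, (le_max_right m N).trans hi, ?_⟩
  rw [← mul_one ε, ← inv_mul_le_iff₀ (pos_iff_ne_zero.2 hε)]
  exact (mul_le_mul_left (hm.trans hcast) _).trans hle

end Concatenation

section Bellman

variable {Q A : Type*} [Fintype Q]

/-- The optimality operator of minimization: the least expectation of `w` after one transition. -/
noncomputable def bellman (M : MDP Q A) (w : Q → ℝ≥0) (q : Q) : ℝ≥0 := ⨅ a, M.tr q a ⬝ᵥ w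

lemma bellman_le (M : MDP Q A) (w : Q → ℝ≥0) (q : Q) (a : A) : M.bellman w q ≤ M.tr q a ⬝ᵥ w :=
  ciInf_le (OrderBot.bddBelow _) a

lemma bellman_smul (M : MDP Q A) (c : ℝ≥0) (w : Q → ℝ≥0) :
    M.bellman (c • w) = c • M.bellman w := by
  ext q
  simp only [bellman, dotProduct_smul, Pi.smul_apply, smul_eq_mul, NNReal.mul_iInf]

lemma iterate_bellman_smul (M : MDP Q A) (c : ℝ≥0) (w : Q → ℝ≥0) (k : ℕ) :
    M.bellman^[k] (c • w) = c • M.bellman^[k] w :=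
  ((Function.Semiconj.iterate_right fun w => (M.bellman_smul c w).symm) k w).symm

lemma Step.dotProduct_bellman_le [Fintype A] {M : MDP Q A} {μ ν : Q → ℝ≥0} (h : M.Step μ ν)
    (w : Q → ℝ≥0) : μ ⬝ᵥ M.bellman w ≤ ν ⬝ᵥ w := by
  obtain ⟨f, hf, rfl⟩ := h
  rw [sum_smul_tr_dotProduct]
  simp only [dotProduct, ← hf, Finset.sum_mul]
  gcongr with q _ a _
  exact bellman_le M w q a

lemma Reach.dotProduct_iterate_bellman_le [Fintype A] {M : MDP Q A} {μ ν : Q → ℝ≥0} {k : ℕ}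
    (h : M.Reach k μ ν) (w : Q → ℝ≥0) : μ ⬝ᵥ M.bellman^[k] w ≤ ν ⬝ᵥ w := by
  induction k generalizing μ with
  | zero => cases h; exact le_rfl
  | succ k ih =>
    obtain ⟨ρ, hstep, hreach⟩ := h
    rw [Function.iterate_succ_apply']
    exact (hstep.dotProduct_bellman_le _).trans (ih hreach)

variable [Finite A] [Nonempty A]

lemma exists_bellman_eq (M : MDP Q A) (w : Q → ℝ≥0) (q : Q) :
    ∃ a, M.bellman w q = M.tr q a ⬝ᵥ w :=
  (exists_eq_ciInf_of_finite (f := fun a => M.tr q a ⬝ᵥ w)).imp fun _ h => h.symm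

lemma bellman_mono (M : MDP Q A) : Monotone M.bellman := fun v w h q => by
  obtain ⟨a, ha⟩ := exists_bellman_eq M w q
  exact (bellman_le M v q a).trans ((tr_dotProduct_mono M q a h).trans_eq ha.symm)

lemma bellman_add_const_le (M : MDP Q A) (w : Q → ℝ≥0) (c : ℝ≥0) :
    M.bellman (w + fun _ => c) ≤ M.bellman w + fun _ => c := fun q => by
  obtain ⟨a, ha⟩ := exists_bellman_eq M w q
  refine (bellman_le M _ q a).trans_eq ?_
  rw [dotProduct_add, tr_dotProduct_const, Pi.add_apply, ha]

lemma iterate_bellman_add_const_le (M : MDP Q A) (w : Q → ℝ≥0) (c : ℝ≥0) (k : ℕ) :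
    M.bellman^[k] (w + fun _ => c) ≤ M.bellman^[k] w + fun _ => c := by
  induction k with
  | zero => exact le_rfl
  | succ k ih =>
    rw [Function.iterate_succ_apply', Function.iterate_succ_apply']
    exact (bellman_mono M ih).trans (bellman_add_const_le M _ c)

end Bellman

section Miss

variable {Q A : Type*} [Fintype Q]

/-- The least probability of being outside `S` after exactly `k` steps. -/
noncomputable def miss (M : MDP Q A) (S : Set Q) (k : ℕ) : Q → ℝ≥0 :=
  M.bellman^[k] (Sᶜ.indicator 1)

lemma miss_zero (M : MDP Q A) (S : Set Q) : M.miss S 0 = Sᶜ.indicator 1 := rfl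

lemma miss_succ (M : MDP Q A) (S : Set Q) (k : ℕ) : M.miss S (k + 1) = M.bellman (M.miss S k) :=
  Function.iterate_succ_apply' _ _ _

lemma miss_add (M : MDP Q A) (S : Set Q) (k l : ℕ) :
    M.miss S (k + l) = M.bellman^[k] (M.miss S l) :=
  Function.iterate_add_apply _ _ _ _

/-- The states from which some action leads into `E` surely. -/
def pre (M : MDP Q A) (E : Set Q) : Set Q := {q | ∃ a, (M.tr q a).support ⊆ E}

/-- The states from which some strategy is surely in `S` after exactly `k` steps. -/
def sure (M : MDP Q A) (S : Set Q) (k : ℕ) : Set Q := M.pre^[k] S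

lemma sure_add (M : MDP Q A) (S : Set Q) (k l : ℕ) :
    M.sure S (k + l) = M.sure (M.sure S l) k :=
  Function.iterate_add_apply _ _ _ _

lemma pre_mono (M : MDP Q A) : Monotone M.pre := fun _ _ h _ => Exists.imp fun _ ha => ha.trans h

lemma subset_sure_mul {M : MDP Q A} {S : Set Q} {k : ℕ} (h : S ⊆ M.sure S k) (j : ℕ) :
    S ⊆ M.sure S (j * k) := by
  induction j with
  | zero => rw [zero_mul]; exact subset_rfl
  | succ j ih =>
    rw [Nat.succ_mul, sure_add]
    exact ih.trans ((pre_mono M).iterate _ h)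

lemma exists_sure_add_eq (M : MDP Q A) (S : Set Q) :
    ∃ k r, 0 < r ∧ k + r ≤ 2 ^ Fintype.card Q ∧ M.sure S (r + k) = M.sure S k := by
  classical
  obtain ⟨i, j, hlt, h⟩ := exists_lt_map_eq_of_card_lt
    (fun i : Fin (2 ^ Fintype.card Q + 1) => M.sure S i) (by simp)
  refine ⟨i, j - i, Nat.sub_pos_of_lt hlt, by omega, ?_⟩
  rw [Nat.sub_add_cancel hlt.le]
  exact h.symm

lemma miss_eq_zero {M : MDP Q A} {S : Set Q} {k : ℕ} {q : Q} (h : q ∈ M.sure S k) :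
    M.miss S k q = 0 := by
  induction k generalizing q with
  | zero => simp [miss_zero, show q ∈ S from h]
  | succ k ih =>
    rw [Nat.add_comm, sure_add] at h
    obtain ⟨a, ha⟩ := h
    rw [miss_succ, ← nonpos_iff_eq_zero]
    exact (bellman_le M _ q a).trans (tr_dotProduct_le fun p hp => (ih (ha hp)).le)

lemma miss_le_one [Nonempty A] (M : MDP Q A) (S : Set Q) (k : ℕ) (q : Q) : M.miss S k q ≤ 1 := by
  induction k generalizing q with
  | zero => exact Set.indicator_le_self' (fun _ _ => zero_le) q
  | succ k ih =>
    rw [miss_succ]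
    exact (bellman_le M _ q (Classical.arbitrary A)).trans (tr_dotProduct_le fun p _ => ih p)

lemma Reach.dotProduct_miss_le [Fintype A] {M : MDP Q A} {S : Set Q} {k : ℕ} {μ ν : Q → ℝ≥0}
    (h : M.Reach k μ ν) : μ ⬝ᵥ M.miss S k ≤ outside S ν :=
  h.dotProduct_iterate_bellman_le _

lemma Reach.miss_lt [Fintype A] {M : MDP Q A} {S : Set Q} {k : ℕ} {μ ν : Q → ℝ≥0}
    (h : M.Reach k μ ν) {q : Q} {θ c : ℝ≥0} (hθ : θ ≤ μ q) (hν : outside S ν < θ * c) :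
    M.miss S k q < c := by
  refine lt_of_mul_lt_mul_left (lt_of_le_of_lt ?_ hν) (zero_le (a := θ))
  calc θ * M.miss S k q ≤ μ q * M.miss S k q := by gcongr
    _ ≤ μ ⬝ᵥ M.miss S k := Finset.single_le_sum (f := fun q => μ q * M.miss S k q)
        (fun _ _ => zero_le) (Finset.mem_univ q)
    _ ≤ outside S ν := h.dotProduct_miss_le

variable [Finite A] [Nonempty A]

lemma miss_add_le {M : MDP Q A} {S E : Set Q} {l : ℕ} {c : ℝ≥0} (h : ∀ p ∈ E, M.miss S l p ≤ c)
    (k : ℕ) (q : Q) : M.miss S (k + l) q ≤ M.miss E k q + c := by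
  have hle : M.miss S l ≤ Eᶜ.indicator 1 + fun _ => c := fun p => by
    by_cases hp : p ∈ E
    · simpa [hp] using h p hp
    · simpa [hp] using (miss_le_one M S l p).trans le_self_add
  rw [miss_add]
  exact ((bellman_mono M).iterate k hle).trans (iterate_bellman_add_const_le M _ c k) q

lemma mul_miss_le {M : MDP Q A} {S E : Set Q} {l : ℕ} {c : ℝ≥0} (h : ∀ p ∉ E, c ≤ M.miss S l p)
    (k : ℕ) (q : Q) : c * M.miss E k q ≤ M.miss S (k + l) q := by
  have hle : c • Eᶜ.indicator 1 ≤ M.miss S l := fun p => by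
    by_cases hp : p ∈ E
    · simp [hp]
    · simpa [hp] using h p hp
  have := (bellman_mono M).iterate k hle q
  rwa [iterate_bellman_smul, ← miss_add] at this

lemma pow_le_miss {M : MDP Q A} {α : ℝ≥0} (hα : M.IsProbLowerBound α) {S : Set Q} {k : ℕ} {q : Q}
    (h : q ∉ M.sure S k) : α ^ k ≤ M.miss S k q := by
  induction k generalizing q with
  | zero => simp [miss_zero, show q ∉ S from h]
  | succ k ih =>
    obtain ⟨a, ha⟩ := exists_bellman_eq M (M.miss S k) q
    rw [Nat.add_comm, sure_add] at h
    obtain ⟨p, hp, hpk⟩ := Set.not_subset.1 fun hsub => h ⟨a, hsub⟩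
    rw [miss_succ, ha, pow_succ']
    exact hα.mul_le_tr_dotProduct hp (ih hpk)

lemma miss_add_le_miss_sure (M : MDP Q A) (S : Set Q) (k l : ℕ) (q : Q) :
    M.miss S (k + l) q ≤ M.miss (M.sure S l) k q := by
  simpa using miss_add_le (fun p hp => (miss_eq_zero hp).le) k q

end Miss

section LimMiss

open Filter Topology

variable {Q A : Type*} [Fintype Q]

/-- The limit of the least probability of being outside `R` after `k + j * r` steps as `j → ∞`.
It is written as an infimum, which is the limit when `R ⊆ M.sure R r`. -/
noncomputable def limMiss (M : MDP Q A) (R : Set Q) (r k : ℕ) (q : Q) : ℝ≥0 :=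
  ⨅ j : ℕ, M.miss R (k + j * r) q

lemma limMiss_le (M : MDP Q A) (R : Set Q) (r k : ℕ) (q : Q) :
    M.limMiss R r k q ≤ M.miss R k q := by
  simpa [limMiss] using ciInf_le (f := fun j : ℕ => M.miss R (k + j * r) q) (OrderBot.bddBelow _) 0

variable [Finite A] [Nonempty A] {M : MDP Q A} {R : Set Q} {r : ℕ}

lemma antitone_miss (hR : R ⊆ M.sure R r) (k : ℕ) (q : Q) :
    Antitone fun j => M.miss R (k + j * r) q := by
  refine antitone_nat_of_succ_le fun j => ?_
  rw [Nat.succ_mul, ← add_assoc]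
  simpa using miss_add_le (fun p hp => (miss_eq_zero (hR hp)).le) (k + j * r) q

lemma tendsto_limMiss (hR : R ⊆ M.sure R r) (k : ℕ) (q : Q) :
    Tendsto (fun j => M.miss R (k + j * r) q) atTop (𝓝 (M.limMiss R r k q)) :=
  tendsto_atTop_ciInf (antitone_miss hR k q) (OrderBot.bddBelow _)

lemma periodic_limMiss (hR : R ⊆ M.sure R r) : Function.Periodic (M.limMiss R r) r := by
  refine fun k => funext fun q => tendsto_nhds_unique (tendsto_limMiss hR (k + r) q) ?_
  refine ((tendsto_add_atTop_iff_nat 1).2 (tendsto_limMiss hR k q)).congr fun j => ?_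
  rw [Nat.succ_mul, add_assoc, add_comm r]

lemma limMiss_succ_le (hR : R ⊆ M.sure R r) (k : ℕ) (q : Q) (a : A) :
    M.limMiss R r (k + 1) q ≤ M.tr q a ⬝ᵥ M.limMiss R r k := by
  refine le_of_tendsto_of_tendsto' (tendsto_limMiss hR (k + 1) q)
    (tendsto_finsetSum _ fun p _ => (tendsto_limMiss hR k p).const_mul (M.tr q a p)) fun j => ?_
  rw [add_right_comm, miss_succ]
  exact bellman_le M _ q a

variable {α β v : ℝ≥0}

-- Below `β` the value `v` is maximal, so an action that avoids all successors of value at least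
-- `β` stays among the states of value exactly `v`, which never meet `R`.
lemma mul_le_miss_of_limMiss_eq (hα : M.IsProbLowerBound α) (hR : R ⊆ M.sure R r)
    (hβ : α * β ≤ 1) (hv : v ≠ 0) (hmax : ∀ k q, M.limMiss R r k q ≤ v ∨ β ≤ M.limMiss R r k q)
    {k : ℕ} {q : Q} (hq : M.limMiss R r k q = v) : α * β ≤ M.miss R k q := by
  induction k generalizing q with
  | zero =>
    have hqR : q ∉ R := fun hmem => hv <| by
      simpa [miss_zero, hmem, hq] using limMiss_le M R r 0 q
    simpa [miss_zero, hqR] using hβ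
  | succ k ih =>
    obtain ⟨a, ha⟩ := exists_bellman_eq M (M.miss R k) q
    rw [miss_succ, ha]
    by_cases hbig : ∃ p ∈ (M.tr q a).support, β ≤ M.limMiss R r k p
    · obtain ⟨p, hp, hpβ⟩ := hbig
      exact hα.mul_le_tr_dotProduct hp (hpβ.trans (limMiss_le M R r k p))
    · push Not at hbig
      have hsmall : ∀ p ∈ (M.tr q a).support, M.limMiss R r k p ≤ v := fun p hp =>
        (hmax k p).resolve_right (hbig p hp).not_ge
      refine le_tr_dotProduct fun p hp => ih ?_
      exact eq_of_le_tr_dotProduct hsmall (hq ▸ limMiss_succ_le hR k q a) hp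

lemma mul_le_of_limMiss_eq (hα : M.IsProbLowerBound α) (hR : R ⊆ M.sure R r)
    (hβ : α * β ≤ 1) (hv : v ≠ 0) (hmax : ∀ k q, M.limMiss R r k q ≤ v ∨ β ≤ M.limMiss R r k q)
    {k : ℕ} {q : Q} (hq : M.limMiss R r k q = v) : α * β ≤ v := by
  rw [← hq]
  refine ge_of_tendsto' (tendsto_limMiss hR k q) fun j =>
    mul_le_miss_of_limMiss_eq hα hR hβ hv hmax ?_
  rw [← hq]
  exact congrFun ((periodic_limMiss hR).nat_mul j k) q

lemma range_limMiss_subset (hR : R ⊆ M.sure R r) (hr : 0 < r) :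
    Set.range (fun x : ℕ × Q => M.limMiss R r x.1 x.2) ⊆
      Set.range (fun x : Fin r × Q => M.limMiss R r x.1 x.2) := by
  rintro _ ⟨⟨k, q⟩, rfl⟩
  exact ⟨(⟨k % r, Nat.mod_lt k hr⟩, q), congrFun ((periodic_limMiss hR).map_mod_nat k) q⟩

lemma limMiss_eq_zero_or_le (hα : M.IsProbLowerBound α) (hR : R ⊆ M.sure R r) (hr : 0 < r)
    (hβ : α * β ≤ 1) (hgap : ∀ k q, M.limMiss R r k q < α * β ∨ β ≤ M.limMiss R r k q)
    (k : ℕ) (q : Q) : M.limMiss R r k q = 0 ∨ β ≤ M.limMiss R r k q := by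
  by_contra! hkq
  let s := Set.range (fun x : ℕ × Q => M.limMiss R r x.1 x.2) ∩ Set.Iio β
  have hfin : s.Finite :=
    ((Set.finite_range _).subset (range_limMiss_subset hR hr)).inter_of_left _
  obtain ⟨v, ⟨⟨⟨i, p⟩, hip⟩, hvβ⟩, hvmax⟩ :=
    Set.exists_max_image s id hfin ⟨_, ⟨(k, q), rfl⟩, hkq.2⟩
  have hmax : ∀ k q, M.limMiss R r k q ≤ v ∨ β ≤ M.limMiss R r k q := fun k q =>
    (lt_or_ge _ β).imp_left fun h => hvmax _ ⟨⟨(k, q), rfl⟩, h⟩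
  have hv : v ≠ 0 := fun h => hkq.1 (by simpa [h, hkq.2.not_ge] using hmax k q)
  replace hip : M.limMiss R r i p = v := hip
  have hlt : v < α * β := hip ▸ (hgap i p).resolve_right (hip.trans_lt hvβ).not_ge
  exact hlt.not_ge (mul_le_of_limMiss_eq hα hR hβ hv hmax hip)

lemma limMiss_eq_zero_or_pow_le (hα : M.IsProbLowerBound α) (hR : R ⊆ M.sure R r)
    (hr : 0 < r) (k : ℕ) (q : Q) :
    M.limMiss R r k q = 0 ∨ α ^ (Fintype.card Q * r) ≤ M.limMiss R r k q := by
  have hpow : Antitone (α ^ ·) := pow_right_anti₀ zero_le (hα.le_one q)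
  obtain ⟨m, hm, hgap⟩ :=
    exists_forall_lt_or_le hpow fun x : Fin r × Q => M.limMiss R r x.1 x.2
  have hgap' : ∀ k q, M.limMiss R r k q < α * α ^ m ∨ α ^ m ≤ M.limMiss R r k q := by
    intro k q
    obtain ⟨x, hx⟩ := range_limMiss_subset hR hr ⟨(k, q), rfl⟩
    simpa only [← pow_succ', ← hx] using hgap x
  refine (limMiss_eq_zero_or_le hα hR hr ?_ hgap' k q).imp_right fun h => ?_
  · exact mul_le_one' (hα.le_one q) (pow_le_one₀ zero_le (hα.le_one q))
  · refine le_trans (hpow (hm.trans_eq ?_)) h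
    rw [Fintype.card_prod, Fintype.card_fin, mul_comm]

end LimMiss

section LimitSure

open Filter Topology

variable {Q A : Type*} [Fintype Q]

/-- The states from which the probability of being in `S` after `k + j * r` steps can be made
arbitrarily close to `1` by taking `j` large: the limit-sure region at phase `k` modulo `r`. -/
def limitSure (M : MDP Q A) (S : Set Q) (r k : ℕ) : Set Q :=
  {q | Tendsto (fun j => M.miss S (k + j * r) q) atTop (𝓝 0)}

variable {M : MDP Q A} {S : Set Q} {α g : ℝ≥0} {r k₀ : ℕ}

lemma limitSure_add_mul (M : MDP Q A) (S : Set Q) (r k i : ℕ) :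
    M.limitSure S r (k + i * r) = M.limitSure S r k := by
  ext q
  have : (fun j => M.miss S (k + i * r + j * r) q) = fun j => M.miss S (k + (j + i) * r) q := by
    simp only [Nat.add_mul, add_assoc, add_comm (i * r)]
  rw [limitSure, Set.mem_ofPred_eq, this,
    tendsto_add_atTop_iff_nat (f := fun j => M.miss S (k + j * r) q) i, limitSure,
    Set.mem_ofPred_eq]

lemma le_miss_add_mul (hg : ∀ k, ∀ q ∉ M.limitSure S r k, g ≤ M.miss S k q) {k : ℕ} {q : Q}
    (hq : q ∉ M.limitSure S r k) (j : ℕ) : g ≤ M.miss S (k + j * r) q :=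
  hg _ q (by rwa [limitSure_add_mul])

variable [Finite A] [Nonempty A]

lemma limitSure_succ_subset_pre (hα : M.IsProbLowerBound α) (hα_ne : α ≠ 0) (hg0 : g ≠ 0)
    (hg : ∀ k, ∀ q ∉ M.limitSure S r k, g ≤ M.miss S k q) (k : ℕ) :
    M.limitSure S r (k + 1) ⊆ M.pre (M.limitSure S r k) := by
  intro q hq
  by_contra hpre
  have hlow : ∀ j, α * g ≤ M.miss S (k + 1 + j * r) q := by
    intro j
    rw [add_right_comm, miss_succ]
    obtain ⟨a, ha⟩ := exists_bellman_eq M (M.miss S (k + j * r)) q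
    obtain ⟨p, hp, hpk⟩ := Set.not_subset.1 fun hsub => hpre ⟨a, hsub⟩
    exact ha ▸ hα.mul_le_tr_dotProduct hp (le_miss_add_mul hg hpk j)
  exact mul_ne_zero hα_ne hg0 (nonpos_iff_eq_zero.1 (ge_of_tendsto' hq hlow))

lemma mem_limitSure_add {a b : ℕ} (hS : S ⊆ M.limitSure S r b) {q : Q}
    (hq : ∀ ε ≠ 0, ∃ i, M.miss S (a + i * r) q ≤ ε) : q ∈ M.limitSure S r (a + b) := by
  refine nhds_bot_basis_Iic.tendsto_right_iff.2 fun ε hε => ?_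
  obtain ⟨i, hi⟩ := hq (ε / 2) (div_ne_zero hε.ne' two_ne_zero)
  have hS' : ∀ᶠ j in atTop, ∀ p ∈ S, M.miss S (b + j * r) p ≤ ε / 2 := by
    refine (eventually_all (ι := Q)).2 fun p => ?_
    exact eventually_imp_distrib_left.2 fun hp => (hS hp).eventually_le_const (half_pos hε)
  filter_upwards [(tendsto_sub_atTop_nat i).eventually hS', eventually_ge_atTop i] with j hj hij
  obtain ⟨j, rfl⟩ := Nat.exists_eq_add_of_le hij
  rw [Nat.add_sub_cancel_left] at hj
  calc M.miss S (a + b + (i + j) * r) q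
      = M.miss S (a + i * r + (b + j * r)) q := by congr 1; ring
    _ ≤ M.miss S (a + i * r) q + ε / 2 := miss_add_le hj _ q
    _ ≤ ε / 2 + ε / 2 := by gcongr
    _ = ε := add_halves ε

lemma subset_limitSure_mul {t : ℕ} (hS : S ⊆ M.limitSure S r t) (i : ℕ) :
    S ⊆ M.limitSure S r (t * (i + 1)) := by
  induction i with
  | zero => simpa using hS
  | succ i ih =>
    intro q hq
    rw [Nat.mul_succ]
    refine mem_limitSure_add hS fun ε hε => ?_
    exact ((ih hq).eventually_le_const (pos_iff_ne_zero.2 hε)).exists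

lemma subset_limitSure_zero {t : ℕ} (hr : 0 < r) (hS : S ⊆ M.limitSure S r t) :
    S ⊆ M.limitSure S r 0 := by
  have := subset_limitSure_mul hS (r - 1)
  rwa [Nat.sub_add_cancel hr, ← Nat.zero_add (t * r), limitSure_add_mul] at this

lemma sure_subset_limitSure (hS : S ⊆ M.limitSure S r 0) (k : ℕ) :
    M.sure S k ⊆ M.limitSure S r k := fun q hq =>
  mem_limitSure_add hS fun ε _ => ⟨0, by simp [miss_eq_zero hq]⟩

lemma pow_le_miss_of_notMem_limitSure (hα : M.IsProbLowerBound α) (hr : 0 < r)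
    (hper : M.sure S (r + k₀) = M.sure S k₀) {k : ℕ} (hk : k₀ ≤ k) {q : Q}
    (hq : q ∉ M.limitSure S r k) : α ^ (k₀ + Fintype.card Q * r) ≤ M.miss S k q := by
  obtain ⟨k, rfl⟩ := Nat.exists_eq_add_of_le' hk
  have hR : M.sure S k₀ ⊆ M.sure (M.sure S k₀) r := by rw [← sure_add, hper]
  rcases limMiss_eq_zero_or_pow_le hα hR hr k q with hzero | hpow
  · refine absurd ?_ hq
    refine tendsto_of_tendsto_of_tendsto_of_le_of_le tendsto_const_nhds
      (hzero ▸ tendsto_limMiss hR k q) (fun _ => zero_le) fun j => ?_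
    rw [add_right_comm]
    exact miss_add_le_miss_sure M S (k + j * r) k₀ q
  · calc α ^ (k₀ + Fintype.card Q * r)
        = α ^ k₀ * α ^ (Fintype.card Q * r) := pow_add _ _ _
      _ ≤ α ^ k₀ * M.miss (M.sure S k₀) k q := by
          gcongr
          exact hpow.trans (limMiss_le M _ r k q)
      _ ≤ M.miss S (k + k₀) q := mul_miss_le (fun p hp => pow_le_miss hα hp) k q

lemma pow_le_miss_of_subset_limitSure_zero (hα : M.IsProbLowerBound α) (hr : 0 < r)
    (hper : M.sure S (r + k₀) = M.sure S k₀) (hS : S ⊆ M.limitSure S r 0) (k : ℕ) (q : Q)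
    (hq : q ∉ M.limitSure S r k) : α ^ (k₀ + Fintype.card Q * r) ≤ M.miss S k q := by
  rcases le_or_gt k₀ k with hk | hk
  · exact pow_le_miss_of_notMem_limitSure hα hr hper hk hq
  · refine (pow_le_pow_of_le_one zero_le (hα.le_one q) (by omega)).trans (pow_le_miss hα ?_)
    exact fun h => hq (sure_subset_limitSure hS k h)

lemma exists_subset_limitSure {k : ℕ} (hα : M.IsProbLowerBound α) (hα_ne : α ≠ 0)
    (hr : 0 < r) (hper : M.sure S (r + k₀) = M.sure S k₀) (hk : 0 < k)
    (hS : ∀ q ∈ S, M.miss S k q < α ^ (k₀ + Fintype.card Q * r)) :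
    ∃ t, S ⊆ M.limitSure S r t := by
  rcases le_or_gt k₀ k with hk₀ | hk₀
  · refine ⟨k, fun q hq => ?_⟩
    by_contra hlim
    exact (hS q hq).not_ge (pow_le_miss_of_notMem_limitSure hα hr hper hk₀ hlim)
  · have hsure : S ⊆ M.sure S k := fun q hq => by
      by_contra hqk
      refine (hS q hq).not_ge ((pow_le_pow_of_le_one zero_le (hα.le_one q) ?_).trans
        (pow_le_miss hα hqk))
      exact hk₀.le.trans le_self_add
    refine ⟨k₀ * k, fun q hq => ?_⟩
    by_contra hlim
    have hle := pow_le_miss_of_notMem_limitSure hα hr hper (Nat.le_mul_of_pos_right k₀ hk) hlim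
    rw [miss_eq_zero (subset_sure_mul hsure k₀ hq), nonpos_iff_eq_zero] at hle
    exact pow_ne_zero _ hα_ne hle

-- Follow the optimal action as long as it does not leave the limit-sure region; an action that may
-- leave it misses `S` with probability at least `α * g`, so the potential is already `1` there.
lemma exists_tr_dotProduct_min_le (hα : M.IsProbLowerBound α) (hα_ne : α ≠ 0) (hg0 : g ≠ 0)
    (hg : ∀ k, ∀ q ∉ M.limitSure S r k, g ≤ M.miss S k q) {k : ℕ} {q : Q}
    (hq : q ∈ M.limitSure S r (k + 1)) :
    ∃ a, (M.tr q a).support ⊆ M.limitSure S r k ∧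
      (M.tr q a ⬝ᵥ fun p => min 1 (M.miss S k p / (α * g))) ≤
        min 1 (M.miss S (k + 1) q / (α * g)) := by
  have hle_one : ∀ a, (M.tr q a ⬝ᵥ fun p => min 1 (M.miss S k p / (α * g))) ≤ 1 := fun a =>
    tr_dotProduct_le fun _ _ => min_le_left _ _
  obtain ⟨a, ha⟩ := exists_bellman_eq M (M.miss S k) q
  by_cases hsub : (M.tr q a).support ⊆ M.limitSure S r k
  · refine ⟨a, hsub, le_min (hle_one a) ?_⟩
    simp only [miss_succ, ha, dotProduct, Finset.sum_div]
    refine Finset.sum_le_sum fun p _ => ?_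
    rw [mul_div_assoc]
    gcongr
    exact min_le_right _ _
  · obtain ⟨b, hb⟩ := limitSure_succ_subset_pre hα hα_ne hg0 hg k hq
    obtain ⟨p, hp, hpk⟩ := Set.not_subset.1 hsub
    refine ⟨b, hb, (hle_one b).trans (le_min le_rfl ?_)⟩
    rw [one_le_div (by positivity), miss_succ, ha]
    exact hα.mul_le_tr_dotProduct hp (hg k p hpk)

end LimitSure

section Follow

open Filter Topology

variable {Q A : Type*} [Fintype Q] [Fintype A] [Nonempty A] {M : MDP Q A}

lemma exists_reach_of_potential {V : ℕ → Set Q} {u : ℕ → Q → ℝ≥0}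
    (h : ∀ k, ∀ q ∈ V (k + 1), ∃ a, (M.tr q a).support ⊆ V k ∧ M.tr q a ⬝ᵥ u k ≤ u (k + 1) q)
    {k : ℕ} {μ : Q → ℝ≥0} (hμ : μ.support ⊆ V k) :
    ∃ ν, M.Reach k μ ν ∧ ν.support ⊆ V 0 ∧ ν ⬝ᵥ u 0 ≤ μ ⬝ᵥ u k := by
  induction k generalizing μ with
  | zero => exact ⟨μ, rfl, hμ, le_rfl⟩
  | succ k ih =>
    have hchoice : ∀ q, ∃ a, q ∈ V (k + 1) →
        (M.tr q a).support ⊆ V k ∧ M.tr q a ⬝ᵥ u k ≤ u (k + 1) q := fun q => by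
      by_cases hq : q ∈ V (k + 1)
      · exact (h k q hq).imp fun _ ha _ => ha
      · exact ⟨Classical.arbitrary A, fun hq' => absurd hq' hq⟩
    choose s hs using hchoice
    obtain ⟨ν, hreach, hν, hle⟩ := ih (μ := ∑ q, μ q • M.tr q (s q)) fun p hp => by
      obtain ⟨q, hμq, hq⟩ : ∃ q, μ q ≠ 0 ∧ M.tr q (s q) p ≠ 0 := by simpa using hp
      exact (hs q (hμ hμq)).1 hq
    refine ⟨ν, ⟨_, Step.of_choice M μ s, hreach⟩, hν, hle.trans ?_⟩
    rw [sum_dotProduct]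
    refine Finset.sum_le_sum fun q _ => ?_
    rw [smul_dotProduct, smul_eq_mul]
    by_cases hq : μ q = 0
    · simp [hq]
    · gcongr
      exact (hs q (hμ hq)).2

lemma exists_reach_limitSure {S : Set Q} {α g : ℝ≥0} {r : ℕ} (hα : M.IsProbLowerBound α)
    (hα_ne : α ≠ 0) (hg0 : g ≠ 0) (hg1 : g ≤ 1)
    (hg : ∀ k, ∀ q ∉ M.limitSure S r k, g ≤ M.miss S k q) (hr : 0 < r) {k : ℕ}
    {μ : Q → ℝ≥0} (hμ : μ.support ⊆ M.limitSure S r k) {ε : ℝ≥0} (hε : ε ≠ 0) :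
    ∃ l ν, M.Reach (l + 1) μ ν ∧ ν.support ⊆ M.limitSure S r 0 ∧ outside S ν ≤ ε := by
  let u : ℕ → Q → ℝ≥0 := fun k q => min 1 (M.miss S k q / (α * g))
  have hlim : Tendsto (fun j => μ ⬝ᵥ u (k + j * r)) atTop (𝓝 0) := by
    rw [← Finset.sum_const_zero (ι := Q) (s := Finset.univ)]
    refine tendsto_finsetSum _ fun q _ => ?_
    by_cases hq : μ q = 0
    · simp [hq]
    · refine tendsto_of_tendsto_of_tendsto_of_le_of_le tendsto_const_nhds ?_
        (fun _ => zero_le) fun j => mul_le_mul_of_nonneg_left (min_le_right _ _) zero_le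
      have : Tendsto (fun j => M.miss S (k + j * r) q) atTop (𝓝 0) := hμ hq
      simpa using (this.div_const (α * g)).const_mul (μ q)
  obtain ⟨j, hj, hj1⟩ := ((hlim.eventually_le_const (pos_iff_ne_zero.2 hε)).and
    (eventually_ge_atTop 1)).exists
  have hμ' : μ.support ⊆ M.limitSure S r (k + j * r) := by rwa [limitSure_add_mul]
  obtain ⟨ν, hreach, hν, hle⟩ := exists_reach_of_potential (u := u)
    (fun k q hq => exists_tr_dotProduct_min_le hα hα_ne hg0 hg hq) hμ'
  have hpos : 0 < k + j * r := by positivity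
  refine ⟨k + j * r - 1, ν, by rwa [Nat.sub_add_cancel hpos], hν, le_trans ?_ (hle.trans hj)⟩
  refine dotProduct_le_dotProduct_of_nonneg_left (fun q => ?_) fun _ => zero_le
  by_cases hq : q ∈ S
  · simp [hq]
  · refine (Set.indicator_of_mem (s := Sᶜ) hq 1).trans_le (le_min le_rfl ?_)
    rw [miss_zero, Set.indicator_of_mem hq, Pi.one_apply, one_le_div (by positivity)]
    exact mul_le_one' (hα.le_one q) hg1

end Follow

section Positions

variable {Q A : Type*} [Fintype Q] [Fintype A] [Nonempty A] {M : MDP Q A} {α : ℝ≥0}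

lemma mem_almostSureWeakly_of_miss_lt [Nonempty Q] [DecidableEq Q] {T : Finset Q} {S : Set Q}
    {d₀ : Distr Q} {k l : ℕ} (hα : M.IsProbLowerBound α) (hα_ne : α ≠ 0) (hST : S ⊆ T) (hk : 0 < k)
    (hS : ∀ q ∈ S, M.miss S k q < α ^ (Fintype.card Q * 2 ^ Fintype.card Q))
    (hl : ∀ q ∈ d₀.toNNReal.support,
      M.miss S l q < α ^ (Fintype.card Q * 2 ^ Fintype.card Q)) :
    d₀ ∈ M.almostSureWeakly T := by
  have hα_le : α ≤ 1 := hα.le_one (Classical.arbitrary Q)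
  obtain ⟨k₀, r, hr, hkr, hper⟩ := exists_sure_add_eq M S
  have hexp : k₀ + Fintype.card Q * r ≤ Fintype.card Q * 2 ^ Fintype.card Q := by
    calc k₀ + Fintype.card Q * r ≤ Fintype.card Q * k₀ + Fintype.card Q * r := by
          gcongr; exact Nat.le_mul_of_pos_left k₀ Fintype.card_pos
      _ = Fintype.card Q * (k₀ + r) := (mul_add _ _ _).symm
      _ ≤ Fintype.card Q * 2 ^ Fintype.card Q := by gcongr
  have hpow : α ^ (Fintype.card Q * 2 ^ Fintype.card Q) ≤ α ^ (k₀ + Fintype.card Q * r) :=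
    pow_le_pow_of_le_one zero_le hα_le hexp
  obtain ⟨t, ht⟩ :=
    exists_subset_limitSure hα hα_ne hr hper hk fun q hq => (hS q hq).trans_le hpow
  have hS0 : S ⊆ M.limitSure S r 0 := subset_limitSure_zero hr ht
  have hgap := pow_le_miss_of_subset_limitSure_zero hα hr hper hS0
  have hd₀ : d₀.toNNReal.support ⊆ M.limitSure S r l := fun q hq => by
    by_contra hlim
    exact ((hl q hq).trans_le hpow).not_ge (hgap l q hlim)
  refine mem_almostSureWeakly_of_recurrent
    (G := {μ | ∃ k, μ.support ⊆ M.limitSure S r k}) ?_ ⟨l, hd₀⟩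
  rintro μ ⟨k, hμ⟩ ε hε
  obtain ⟨j, ν, hreach, hν, hle⟩ := exists_reach_limitSure hα hα_ne (pow_ne_zero _ hα_ne)
    (pow_le_one₀ zero_le hα_le) hgap hr hμ hε
  exact ⟨j, ν, hreach, ⟨0, hν⟩, (outside_anti hST ν).trans hle⟩

lemma mem_almostSureWeakly_of_strictMono [Nonempty Q] [DecidableEq Q] {T : Finset Q} {d₀ : Distr Q}
    {α₀ : ℝ≥0} {d : ℕ → Q → ℝ≥0} {e : Fin (2 ^ Fintype.card Q + 1) → ℕ}
    (hα : M.IsProbLowerBound α) (hα_ne : α ≠ 0)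
    (hα₀ : ∀ q ∈ d₀.toNNReal.support, α₀ ≤ d₀.toNNReal q)
    (hα₀_ne : α₀ ≠ 0) (hd0 : d 0 = d₀.toNNReal) (hd : ∀ i, M.Step (d i) (d (i + 1)))
    (he : StrictMono e)
    (hout : ∀ m, outside T (d (e m)) <
      α₀ * (α ^ (Fintype.card Q * 2 ^ Fintype.card Q) / Fintype.card Q) ^
        (2 ^ Fintype.card Q + 1)) :
    d₀ ∈ M.almostSureWeakly T := by
  set K := Fintype.card Q * 2 ^ Fintype.card Q
  set b : ℝ≥0 := α ^ K / Fintype.card Q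
  have hcard : (Fintype.card Q : ℝ≥0) ≠ 0 := Nat.cast_ne_zero.2 Fintype.card_ne_zero
  have hb0 : b ≠ 0 := div_ne_zero (pow_ne_zero _ hα_ne) hcard
  have hb1 : b ≤ 1 := div_le_one_of_le₀
    ((pow_le_one₀ zero_le (hα.le_one (Classical.arbitrary Q))).trans
      (mod_cast Nat.one_le_of_lt Fintype.card_pos)) zero_le
  have hθ : Antitone fun m => α₀ * b ^ m := fun _ _ h =>
    mul_le_mul_right (pow_right_anti₀ zero_le hb1 h) α₀
  let S : Fin (2 ^ Fintype.card Q + 1) → Set Q := fun m => {q | α₀ * b ^ (m + 1 : ℕ) ≤ d (e m) q}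
  have hST : ∀ m, S m ⊆ T := fun m q hq => by
    by_contra hqT
    exact ((le_outside hqT _).trans_lt (hout m)).not_ge ((hθ m.2).trans hq)
  have hS : ∀ m, outside (S m) (d (e m)) < α₀ * b ^ (m : ℕ) * α ^ K := fun m => by
    refine (outside_setOf_le_lt (mul_ne_zero hα₀_ne (pow_ne_zero _ hb0)) _).trans_eq ?_
    rw [pow_succ, ← mul_div_cancel₀ (α ^ K) hcard]
    ring
  obtain ⟨i, j, hij, hSij⟩ := exists_lt_map_eq_of_card_lt S (by simp)
  refine mem_almostSureWeakly_of_miss_lt hα hα_ne (hST i) (Nat.sub_pos_of_lt (he hij))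
    (fun q hq => ?_) (fun q hq => ?_) (l := e i)
  · have hreach := Reach.of_steps hd (e i) (e j - e i)
    rw [Nat.add_sub_of_le (he hij).le] at hreach
    refine hreach.miss_lt hq ?_
    rw [hSij]
    exact (hS j).trans_le (by gcongr ?_ * _; exact hθ hij)
  · have hreach := Reach.of_steps hd 0 (e i)
    rw [zero_add, hd0] at hreach
    exact hreach.miss_lt (hα₀ q hq) ((hS i).trans_le (by gcongr; simpa using hθ (Nat.zero_le i)))

end Positions

end MDP

theorem theorem2 {Q A : Type*} [Fintype Q] [DecidableEq Q] [Fintype A]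
    (M : MDP Q A) (T : Finset Q) (d₀ : Distr Q)
    (n : ℕ) (hn : n = Fintype.card Q)
    (α : ℝ) (hα : IsLeast M.positiveProbs α)
    (α₀ : ℝ) (hα₀ : IsLeast {p : ℝ | 0 < p ∧ ∃ q, d₀ q = p} α₀)
    (εw : ℝ) (hεw : εw = α₀ * (α ^ ((n + 2) * 4 ^ n) / (n : ℝ) ^ (2 ^ n + 1)))
    (Nw : ℕ) (hNw : Nw = 2 ^ n)
    (hd₀ : d₀ ∉ M.almostSureWeakly T) (σ : Strategy Q A) :
    {i : ℕ | IsStrictlySynchronized (1 - εw) (M.outcome d₀ σ i) T}.encard ≤ (Nw : ℕ∞) := by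
  by_contra hcard
  obtain ⟨e, he, hes⟩ := exists_strictMono_of_lt_encard (not_le.1 hcard)
  obtain ⟨⟨hαpos, q, a, -⟩, hαle⟩ := hα
  obtain ⟨⟨hα₀pos, -⟩, hα₀le⟩ := hα₀
  have : Nonempty A := ⟨a⟩
  have : Nonempty Q := ⟨q⟩
  lift α to ℝ≥0 using hαpos.le
  lift α₀ to ℝ≥0 using hα₀pos.le
  subst hn hNw hεw
  have hbound : M.IsProbLowerBound α := fun q a q' h =>
    hαle ⟨NNReal.coe_pos.2 (pos_iff_ne_zero.2 h), q, a, q', rfl⟩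
  refine hd₀ (MDP.mem_almostSureWeakly_of_strictMono hbound (NNReal.coe_pos.1 hαpos).ne'
    (fun q hq => hα₀le ⟨NNReal.coe_pos.2 (pos_iff_ne_zero.2 hq), q, rfl⟩)
    (NNReal.coe_pos.1 hα₀pos).ne' (M.outcomeMeasure_zero d₀ σ) (M.step_outcomeMeasure d₀ σ) he
    fun m => ?_)
  have hsync : 1 - _ < mass (M.outcome d₀ σ (e m)) T := hes m
  rw [MDP.mass_outcome, sub_lt_sub_iff_left] at hsync
  exact (NNReal.coe_lt_coe.1 (mod_cast hsync)).trans_le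
    (mul_le_mul_right (pow_div_pow_le (hbound.le_one q) _) α₀)
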